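/- Let $0<q<1$, $0<t<1$, and let $a\in\mathbb C$, $a\ne0$, be generic in the sense that $q^it^ja^2\neq1$ for all integers $i\ge1$, $j\ge0$. Write $(b;q)_k=\prod_{j=0}^{k-1}(1-bq^j)$, $(b_1,\dots,b_r;q)_k=\prod_i(b_i;q)_k$, and $${}_4\phi_3\!\left({q^{-N},b_2,b_3,b_4\atop c_1,c_2,c_3};q,z\right)=\sum_{k=0}^N\frac{(q^{-N},b_2,b_3,b_4;q)_k}{(q,c_1,c_2,c_3;q)_k}\,z^k .$$ For integers $m_1\ge m_2\ge0$, the $BC_2$-type interpolation Macdonald polynomial $P=P^{\rm ip}_{m_1,m_2}(x_1,x_2;q,t,a)$ is a Laurent polynomial over $\mathbb C$ in $x_1,x_2$ that is invariant under $x_1\leftrightarrow x_2$ and under each inversion $x_i\mapsto x_i^{-1}$, has degree $m_1+m_2$ (the highest total degree of its monomials), has coefficient $1$ at $x_1^{m_1}x_2^{m_2}$, and satisfies $$P(q^{\mu_1}ta,\,q^{\mu_2}a)=0\quad\text{for all integers }\mu_1\ge\mu_2\ge0\text{ for which }\mu_1\ge m_1,\ \mu_2\ge m_2\text{ do not both hold.}$$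 There is exactly one such $P$. Put $m=m_1-m_2$ and $$C(x_1,x_2)=\frac{q^{-\frac12m_1(m_1-1)-\frac12m_2(m_2-1)}}{(-t)^{m_1-m_2}\,a^{m_1+m_2}}\,(ax_1,ax_1^{-1},ax_2,ax_2^{-1};q)_{m_2}.$$ Then the following hold for all nonzero $x_1,x_2\in\mathbb C$. (i) If $(q^{m_2}tax_1,q^{m_2}tax_1^{-1};q)_{m}\ne0$, then $$P^{\rm ip}_{m_1,m_2}(x_1,x_2;q,t,a)=C(x_1,x_2)\,(q^{m_2}tax_1,q^{m_2}tax_1^{-1};q)_{m}\;{}_4\phi_3\!\left({q^{-m},\,t,\,q^{m_2}ax_2,\,q^{m_2}ax_2^{-1}\atop q^{1-m}t^{-1},\,q^{m_2}tax_1,\,q^{m_2}tax_1^{-1}};q,q\right),$$ and this series is balanced: the product of its lower parameters is $q$ times the product of its upper parameters (the latter holds without the restriction on $x_1$). (ii) Without that restriction, $$P^{\rm ip}_{m_1,m_2}(x_1,x_2;q,t,a)=C(x_1,x_2)\sum_{k=0}^{m}\frac{(q^{-m},t;q)_k\,q^k}{(q^{1-m}t^{-1},q;q)_k}\,(q^{m_2+k}tax_1,q^{m_2+k}tax_1^{-1};q)_{m-k}\,(q^{m_2}ax_2,q^{m_2}ax_2^{-1};q)_k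 .$$ (iii) If $(q^{2m_2}ta^2;q)_{m}\ne0$ (which, for generic $a$ as above, excludes only the case $m_2=0<m_1$, $ta^2=1$), then $$P^{\rm ip}_{m_1,m_2}(x_1,x_2;q,t,a)=C(x_1,x_2)\,(t,q^{2m_2}ta^2;q)_{m}\sum_{\substack{j,k\ge0\\ j+k\le m}}\frac{(q^{-m};q)_{j+k}\,q^{j+k}}{(q^{2m_2}ta^2;q)_{j+k}}\,\frac{(q^{m_2}ax_1,q^{m_2}ax_1^{-1};q)_j}{(q^{1-m}t^{-1},q;q)_j}\,\frac{(q^{m_2}ax_2,q^{m_2}ax_2^{-1};q)_k}{(q^{1-m}t^{-1},q;q)_k},$$ an expression that is manifestly symmetric in $x_1,x_2$. -/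

import Mathlib

/-- The `q`-shifted factorial `(a;q)_k = (1-a)(1-aq)⋯(1-aq^{k-1})`. -/
noncomputable def qPoch (a q : ℂ) (k : ℕ) : ℂ :=
  ∏ j ∈ Finset.range k, (1 - a * q ^ j)

/-- The multiple `q`-shifted factorial `(a₁,…,a_r;q)_k = (a₁;q)_k ⋯ (a_r;q)_k`. -/
noncomputable def qPochs (as : List ℂ) (q : ℂ) (k : ℕ) : ℂ :=
  (as.map fun a => qPoch a q k).prod

/-- The terminating basic hypergeometric series
`₄φ₃(q^{-N}, a₂, a₃, a₄; b₁, b₂, b₃; q, z)`. -/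
noncomputable def phi43 (N : ℕ) (a₂ a₃ a₄ b₁ b₂ b₃ q z : ℂ) : ℂ :=
  ∑ k ∈ Finset.range (N + 1),
    qPochs [q ^ (-(N : ℤ)), a₂, a₃, a₄] q k / qPochs [q, b₁, b₂, b₃] q k * z ^ k

/-- Complex Laurent polynomials in `x_1, …, x_n`: the element `P` stands for
`∑_μ (coefficient of P at μ) x^μ`, with `μ` running over `ℤ^n`. -/
abbrev LaurentPoly (n : ℕ) : Type := AddMonoidAlgebra ℂ (Fin n → ℤ)

namespace LaurentPoly

/-- The coefficient of `x^μ` in `P`. -/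
def coefficient {n : ℕ} (P : LaurentPoly n) (μ : Fin n → ℤ) : ℂ := P.coeff μ

/-- The value of `P` at a point `x` with nonzero coordinates. -/
noncomputable def value {n : ℕ} (P : LaurentPoly n) (x : Fin n → ℂ) : ℂ :=
  ∑ μ ∈ P.coeff.support, P.coefficient μ * ∏ i, x i ^ μ i

/-- Invariance under `W_n = S_n ⋉ (ℤ/2)^n`, which permutes the variables and inverts
some of them. -/
def IsWInvariant {n : ℕ} (P : LaurentPoly n) : Prop :=
  ∀ (σ : Equiv.Perm (Fin n)) (ε : Fin n → ℤˣ) (μ : Fin n → ℤ),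
    P.coefficient (fun i => (ε i : ℤ) * μ (σ i)) = P.coefficient μ

/-- `P` has degree `d`: the highest total degree `μ_1 + ⋯ + μ_n` of a monomial `x^μ`
occurring in `P` is `d`. -/
def HasDegree {n : ℕ} (P : LaurentPoly n) (d : ℤ) : Prop :=
  IsGreatest {e : ℤ | ∃ μ : Fin n → ℤ, P.coefficient μ ≠ 0 ∧ ∑ i, μ i = e} d

end LaurentPoly

/-- `P` is the `BC_n`-type interpolation Macdonald polynomial `P^{ip}_λ(x; q, t, a)`: it is a
`W_n`-invariant Laurent polynomial of degree `|λ|`, it is `λ`-monic (for a `W_n`-invariant `P` the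
coefficient of the orbit sum of `x^λ` is the coefficient of `x^λ`), and it vanishes at
`q^μ t^δ a = (q^{μ_1} t^{n-1} a, …, q^{μ_n} a)` for every partition `μ` that does not
contain `λ`. Indices start at `0`, so `δ_i = n - 1 - i`. -/
structure IsBCInterpolation {n : ℕ} (q t : ℝ) (a : ℂ) (lam : Fin n → ℕ) (P : LaurentPoly n) :
    Prop where
  invariant : P.IsWInvariant
  degree : P.HasDegree (∑ i, (lam i : ℤ))
  monic : P.coefficient (fun i => (lam i : ℤ)) = 1
  vanishing : ∀ μ : Fin n → ℕ, Antitone μ → ¬ lam ≤ μ →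
    P.value (fun i => (q : ℂ) ^ μ i * (t : ℂ) ^ (n - 1 - (i : ℕ)) * a) = 0

/-- The prefactor
`q^{-m₁(m₁-1)/2 - m₂(m₂-1)/2} / ((-t)^{m₁-m₂} a^{m₁+m₂}) · (ax₁, a/x₁, ax₂, a/x₂; q)_{m₂}`
(used for `m₂ ≤ m₁`). -/
noncomputable def bc2Prefactor (q t a : ℂ) (m₁ m₂ : ℕ) (x₁ x₂ : ℂ) : ℂ :=
  q ^ (-((m₁ * (m₁ - 1) / 2 : ℕ) : ℤ) - ((m₂ * (m₂ - 1) / 2 : ℕ) : ℤ))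
    / ((-t) ^ (m₁ - m₂) * a ^ (m₁ + m₂))
    * qPochs [a * x₁, a * x₁⁻¹, a * x₂, a * x₂⁻¹] q m₂

/-! An explicit candidate `bcPoly` is built from the single sum `bcSum`, written in `X_i = x_i +
x_i⁻¹` so that invariance under inversion is automatic. Symmetry in `X_1, X_2` is the nontrivial
point. Expanding each first-variable factor, whose base is `t q^k b`, in the products with base `b`
(`qPochSymm_mul_eq_sum`) turns the single sum into a double sum with coefficients symmetric in `j,
k` (`bcSum_eq_symm`). Since these identities hold in every commutative `ℂ`-algebra, they give both
the invariance of the Laurent polynomial and formula (iii) for its values.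

At a node `(q^μ₁ t a, q^μ₂ a)` with `μ` not containing `λ`, every term of the single sum has a zero
factor, while at the node of `λ` itself exactly one term survives and genericity keeps it nonzero
(`bcPoly_vanishing`, `bcPoly_value_self_ne_zero`).

For uniqueness, the `bcPoly` are unitriangular with respect to orbits of exponents, so the
difference of two solutions is a combination of them, of degree at most `|λ|`. Evaluating at the
node of an index of minimal size in that combination isolates its coefficient. This forces the index
to be `λ`, and the monic condition then rules out `λ` as well. The displayed formulas follow by
rewriting coefficients with reversed `q`-shifted factorials. -/

open Finset LaurentPoly

/-! ### Elementary rules for `q`-shifted factorials. -/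

section QPoch

variable {q : ℂ}

@[simp] lemma qPoch_zero (b : ℂ) : qPoch b q 0 = 1 := by simp [qPoch]

lemma qPoch_succ (b : ℂ) (k : ℕ) : qPoch b q (k + 1) = qPoch b q k * (1 - b * q ^ k) := by
  simp [qPoch, prod_range_succ]

lemma qPoch_add (b : ℂ) (m n : ℕ) :
    qPoch b q (m + n) = qPoch b q m * qPoch (b * q ^ m) q n := by
  simp only [qPoch, prod_range_add, pow_add, mul_assoc]

lemma qPoch_succ' (b : ℂ) (k : ℕ) : qPoch b q (k + 1) = (1 - b) * qPoch (b * q) q k := by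
  rw [add_comm, qPoch_add]
  simp [qPoch]

lemma qPoch_ne_zero {b : ℂ} {k : ℕ} (h : ∀ j < k, b * q ^ j ≠ 1) : qPoch b q k ≠ 0 := by
  rw [qPoch, prod_ne_zero_iff]
  exact fun j hj => sub_ne_zero.2 (h j (mem_range.1 hj)).symm

lemma qPoch_eq_zero {b : ℂ} {j k : ℕ} (hj : j < k) (h : b * q ^ j = 1) : qPoch b q k = 0 :=
  prod_eq_zero (mem_range.2 hj) (by rw [h, sub_self])

end QPoch

/-! ### Change of base in the products `(bx, bx⁻¹; q)_k`. -/

section Expansion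

variable {R : Type*} [CommRing R] [Algebra ℂ R]

/-- The product `(bx, bx⁻¹; q)_k` as a polynomial in `X = x + x⁻¹`. -/
noncomputable def qPochSymm (q b : ℂ) (X : R) (k : ℕ) : R :=
  ∏ j ∈ range k, (algebraMap ℂ R (1 + (b * q ^ j) ^ 2) - (b * q ^ j) • X)

@[simp] lemma qPochSymm_zero (q b : ℂ) (X : R) : qPochSymm q b X 0 = 1 := by simp [qPochSymm]

lemma qPochSymm_succ (q b : ℂ) (X : R) (k : ℕ) :
    qPochSymm q b X (k + 1)
      = qPochSymm q b X k * (algebraMap ℂ R (1 + (b * q ^ k) ^ 2) - (b * q ^ k) • X) := by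
  simp [qPochSymm, prod_range_succ]

lemma qPochSymm_complex (q b : ℂ) {x : ℂ} (hx : x ≠ 0) (k : ℕ) :
    qPochSymm q b (x + x⁻¹) k = qPoch (b * x) q k * qPoch (b * x⁻¹) q k := by
  rw [qPochSymm, qPoch, qPoch, ← prod_mul_distrib]
  refine prod_congr rfl fun j _ => ?_
  simp only [Algebra.algebraMap_self, RingHom.id_apply, smul_eq_mul]
  field_simp
  ring

lemma map_qPochSymm {S : Type*} [CommRing S] [Algebra ℂ S] (f : R →ₐ[ℂ] S) (q b : ℂ) (X : R)
    (k : ℕ) : f (qPochSymm q b X k) = qPochSymm q b (f X) k := by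
  simp [qPochSymm, map_prod]

/-- A Pascal-type step: `α` weights the move raising the second index, `β` the move raising the
first, and the interior coefficients collect both. -/
lemma sum_antidiagonal_succ_of_recurrence (c α β : ℕ × ℕ → ℂ) (w : ℕ → R)
    (h0 : ∀ l, c (0, l + 1) = α (0, l) * c (0, l))
    (h1 : ∀ j, c (j + 1, 0) = β (j, 0) * c (j, 0))
    (h : ∀ j l, c (j + 1, l + 1) = α (j + 1, l) * c (j + 1, l) + β (j, l + 1) * c (j, l + 1))
    (n : ℕ) :
    ∑ p ∈ antidiagonal (n + 1), c p • w p.1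
      = ∑ p ∈ antidiagonal n, (c p * α p) • w p.1
        + ∑ p ∈ antidiagonal n, (c p * β p) • w (p.1 + 1) := by
  cases n with
  | zero => simp [Nat.antidiagonal_succ, h0, h1, mul_comm]
  | succ n =>
    rw [Nat.antidiagonal_succ_succ', Nat.sum_antidiagonal_succ (n := n),
      Nat.sum_antidiagonal_succ' (n := n)]
    simp only [sum_cons, sum_map, Function.Embedding.prodMap, Function.Embedding.coeFn_mk,
      Prod.map, Nat.succ_eq_add_one, h0, h1, h, add_smul,
      sum_add_distrib]
    simp only [mul_comm]
    abel

/-- The coefficients in the expansion of `qPochSymm q (τ * b)` in terms of `qPochSymm q b`. -/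
noncomputable def shiftCoeff (q τ b : ℂ) (p : ℕ × ℕ) : ℂ :=
  qPoch q q (p.1 + p.2) / (qPoch q q p.1 * qPoch q q p.2) * τ ^ p.1
    * qPoch (τ * b ^ 2 * q ^ p.1) q p.2 * qPoch τ q p.2

/-- The polynomial form of the `q`-Saalschütz sum. -/
theorem qPochSymm_mul_eq_sum {q : ℂ} (hq : ∀ n, qPoch q q n ≠ 0) (τ b : ℂ) (X : R) (n : ℕ) :
    qPochSymm q (τ * b) X n
      = ∑ p ∈ antidiagonal n, shiftCoeff q τ b p • qPochSymm q b X p.1 := by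
  have hq' : ∀ n, 1 - q * q ^ n ≠ 0 := fun n => by
    have := hq (n + 1)
    rw [qPoch_succ] at this
    exact right_ne_zero_of_mul this
  induction n with
  | zero => simp [shiftCoeff]
  | succ n ih =>
    -- With `n = j + l`, the new factor `1 + (τbq^n)² - τbq^n X` equals `α + β (1 + (bq^j)² - bq^j
    -- X)`. Comparing coefficients of `X` gives `β = τq^l`, and the constant term then factors as
    -- the stated `α`.
    rw [sum_antidiagonal_succ_of_recurrence (shiftCoeff q τ b)
      (fun p => (1 - τ * b ^ 2 * q ^ (p.1 + p.2 + p.1)) * (1 - τ * q ^ p.2))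
      (fun p => τ * q ^ p.2), qPochSymm_succ, ih, sum_mul, ← sum_add_distrib]
    · refine sum_congr rfl fun p hp => ?_
      obtain rfl := mem_antidiagonal.1 hp
      rw [qPochSymm_succ]
      simp only [Algebra.algebraMap_eq_smul_one, mul_sub, mul_smul_comm, smul_mul_assoc, mul_one]
      module
    · intro l
      simp only [shiftCoeff, qPoch_succ, zero_add, add_zero]
      have := hq l
      have := hq' l
      field_simp
    · intro j
      simp only [shiftCoeff, qPoch_succ, add_zero, qPoch_zero]
      have := hq j
      have := hq' j
      field_simp
      ring
    · intro j l
      have e1 : qPoch (τ * b ^ 2 * q ^ j) q (l + 1)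
        = (1 - τ * b ^ 2 * q ^ j) * qPoch (τ * b ^ 2 * q ^ (j + 1)) q l := by
        rw [qPoch_succ', pow_succ q, ← mul_assoc]
      have e2 : j + 1 + (l + 1) = (j + l + 1) + 1 := by ring
      have e3 : j + 1 + l = j + l + 1 := by ring
      have e4 : j + (l + 1) = j + l + 1 := by ring
      simp only [shiftCoeff, e1, e2, e3, e4, qPoch_succ]
      have := hq l
      have := hq' l
      have := hq j
      have := hq' j
      field_simp
      ring

end Expansion

/-! ### The single sum and its symmetric double-sum form. -/

section TwoVariables

variable {R : Type*} [CommRing R] [Algebra ℂ R]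

/-- The coefficients of `bcSum`. -/
noncomputable def bcCoeff (q t : ℂ) (N k : ℕ) : ℂ :=
  t ^ k * (qPoch q q N / (qPoch q q k * qPoch q q (N - k)))
    * (qPoch t q k * qPoch t q (N - k) / qPoch t q N)

/-- The single sum for the two-variable polynomial, in terms of `X_i = x_i + x_i⁻¹`. -/
noncomputable def bcSum (q t b : ℂ) (N : ℕ) (X Y : R) : R :=
  ∑ k ∈ range (N + 1), bcCoeff q t N k • (qPochSymm q (t * q ^ k * b) X (N - k) * qPochSymm q b Y k)

/-- The coefficients of the symmetric double sum. -/
noncomputable def bcCoeffSymm (q t b : ℂ) (N j k : ℕ) : ℂ :=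
  t ^ (j + k) * q ^ (j * k) * (qPoch q q N / (qPoch q q j * qPoch q q k * qPoch q q (N - j - k)))
    * (qPoch t q (N - j) * qPoch t q (N - k) / qPoch t q N)
    * qPoch (t * b ^ 2 * q ^ (j + k)) q (N - j - k)

lemma bcCoeffSymm_comm (q t b : ℂ) (N j k : ℕ) :
    bcCoeffSymm q t b N j k = bcCoeffSymm q t b N k j := by
  rw [bcCoeffSymm, bcCoeffSymm, Nat.sub_right_comm, add_comm j, mul_comm j,
    mul_comm (qPoch q q j), mul_comm (qPoch t q (N - j))]

/-- With `τ = t q^k`, the power `τ^j` supplies `q^(jk)`, and `(t;q)_k (tq^k;q)_l` merges into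
`(t;q)_(k+l)`. This is what makes the result symmetric in `j, k`. -/
lemma bcCoeff_mul_shiftCoeff {q t : ℂ} (hq : ∀ n, qPoch q q n ≠ 0) (b : ℂ) (j k l : ℕ) :
    bcCoeff q t (j + k + l) k * shiftCoeff q (t * q ^ k) b (j, l)
      = bcCoeffSymm q t b (j + k + l) j k := by
  have e1 : j + k + l - k = j + l := by omega
  have e2 : j + k + l - j = k + l := by omega
  have e3 : k + l - k = l := by omega
  have e4 : t * q ^ k * b ^ 2 * q ^ j = t * b ^ 2 * q ^ (j + k) := by ring
  simp only [bcCoeff, shiftCoeff, bcCoeffSymm, e1, e2, e3, e4, qPoch_add t k l]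
  have := hq j
  have := hq k
  have := hq l
  have := hq (j + l)
  field_simp
  ring

theorem bcSum_eq_symm {q t : ℂ} (hq : ∀ n, qPoch q q n ≠ 0) (b : ℂ) (N : ℕ) (X Y : R) :
    bcSum q t b N X Y = ∑ j ∈ range (N + 1), ∑ k ∈ range (N - j + 1),
      bcCoeffSymm q t b N j k • (qPochSymm q b X j * qPochSymm q b Y k) := by
  have h : bcSum q t b N X Y = ∑ k ∈ range (N + 1), ∑ j ∈ range (N - k + 1),
      bcCoeffSymm q t b N j k • (qPochSymm q b X j * qPochSymm q b Y k) := by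
    refine sum_congr rfl fun k hk => ?_
    rw [qPochSymm_mul_eq_sum hq, Nat.sum_antidiagonal_eq_sum_range_succ_mk, sum_mul, smul_sum]
    refine sum_congr rfl fun j hj => ?_
    obtain ⟨l, rfl⟩ : ∃ l, N = j + k + l := ⟨N - j - k, by
      have := mem_range.1 hj; have := mem_range.1 hk; omega⟩
    rw [← bcCoeff_mul_shiftCoeff hq, smul_mul_assoc, smul_smul,
      show j + k + l - k - j = l by omega]
  rw [h]
  exact sum_comm' fun j k => by simp only [mem_range]; omega

theorem bcSum_comm {q t : ℂ} (hq : ∀ n, qPoch q q n ≠ 0) (b : ℂ) (N : ℕ) (X Y : R) :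
    bcSum q t b N X Y = bcSum q t b N Y X := by
  rw [bcSum_eq_symm hq, bcSum_eq_symm hq,
    sum_comm' (t' := range (N + 1)) (s' := fun j => range (N - j + 1))
      (fun j k => by simp only [mem_range]; omega)]
  refine sum_congr rfl fun j _ => sum_congr rfl fun k _ => ?_
  rw [bcCoeffSymm_comm, mul_comm (qPochSymm q b X k)]

lemma map_bcSum {S : Type*} [CommRing S] [Algebra ℂ S] (f : R →ₐ[ℂ] S) (q t b : ℂ) (N : ℕ)
    (X Y : R) : f (bcSum q t b N X Y) = bcSum q t b N (f X) (f Y) := by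
  simp [bcSum, map_sum, map_qPochSymm]

end TwoVariables

/-! ### Matching with the hypergeometric coefficients. -/

section Coefficients

/-- These products are the sign and power factors produced by reversal; their failure to be
multiplicative in the length accounts for the `q^(jk)` in `bcCoeffSymm`. -/
lemma prod_neg_zpow_mul (q : ℂ) (hq : q ≠ 0) (m j k : ℕ) :
    (∏ i ∈ range j, -q ^ ((m : ℤ) - 1 - i)) * (∏ i ∈ range k, -q ^ ((m : ℤ) - 1 - i))
      = q ^ (j * k) * ∏ i ∈ range (j + k), -q ^ ((m : ℤ) - 1 - i) := by
  rw [prod_range_add, mul_left_comm]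
  congr 1
  rw [mul_comm j k, pow_mul, ← pow_right_comm, ← card_range k, ← prod_const, card_range,
    ← prod_mul_distrib]
  refine prod_congr rfl fun i _ => ?_
  rw [mul_neg, ← zpow_natCast, ← zpow_add₀ hq]
  push_cast
  congr 2
  ring

/-- Factor by factor, `(1 - q^(1-m+i) c⁻¹)(-c q^(m-1-i)) = 1 - c q^(m-1-i)`, so the top `k` factors
of `(c;q)_m` are restored. -/
lemma qPoch_reversal {q c : ℂ} (hq : q ≠ 0) (hc : c ≠ 0) {m k : ℕ} (hk : k ≤ m) :
    qPoch (q ^ (1 - (m : ℤ)) * c⁻¹) q k * qPoch c q (m - k)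
        * (c ^ k * ∏ i ∈ range k, -q ^ ((m : ℤ) - 1 - i)) = qPoch c q m := by
  induction k with
  | zero => simp
  | succ k ih =>
    rw [← ih (by omega)]
    obtain ⟨l, rfl⟩ : ∃ l, m = l + k + 1 := ⟨m - k - 1, by omega⟩
    rw [show l + k + 1 - k = l + 1 by omega, show l + k + 1 - (k + 1) = l by omega, qPoch_succ,
      qPoch_succ, prod_range_succ]
    have e1 : q ^ (1 - ((l + k + 1 : ℕ) : ℤ)) * q ^ k = (q ^ l)⁻¹ := by
      rw [← zpow_natCast, ← zpow_add₀ hq, ← zpow_natCast q l, ← zpow_neg]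
      congr 1; push_cast; ring
    have e2 : q ^ (((l + k + 1 : ℕ) : ℤ) - 1 - k) = q ^ l := by
      rw [← zpow_natCast q l]; congr 1; push_cast; ring
    have e3 : (1 - q ^ (1 - ((l + k + 1 : ℕ) : ℤ)) * c⁻¹ * q ^ k) * (c * -q ^ l) = 1 - c * q ^ l := by
      rw [mul_right_comm, e1]
      field_simp
      ring
    rw [e2, ← e3]
    ring

lemma qPoch_reversal_self {q : ℂ} (hq : q ≠ 0) {m k : ℕ} (hk : k ≤ m) :
    qPoch (q ^ (-(m : ℤ))) q k * qPoch q q (m - k)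
        * (q ^ k * ∏ i ∈ range k, -q ^ ((m : ℤ) - 1 - i)) = qPoch q q m := by
  rw [← qPoch_reversal hq hq hk, sub_eq_neg_add 1, zpow_add₀ hq, zpow_one, mul_inv_cancel_right₀ hq]

lemma prod_neg_zpow_ne_zero {q : ℂ} (hq : q ≠ 0) (m k : ℕ) :
    ∏ i ∈ range k, -q ^ ((m : ℤ) - 1 - i) ≠ 0 :=
  prod_ne_zero_iff.2 fun _ _ => neg_ne_zero.2 (zpow_ne_zero _ hq)

/-- Reversal with `c = q` in the numerator and `c = t` in the denominator gives the same sign and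
power product, which cancels and leaves `t^k`. -/
lemma bcCoeff_eq {q t : ℂ} (hq0 : q ≠ 0) (ht0 : t ≠ 0) (hq : ∀ n, qPoch q q n ≠ 0)
    (ht : ∀ n, qPoch t q n ≠ 0) {m k : ℕ} (hk : k ≤ m) :
    qPochs [q ^ (-(m : ℤ)), t] q k * q ^ k / qPochs [q ^ (1 - (m : ℤ)) * t⁻¹, q] q k
      = bcCoeff q t m k := by
  have h1 := qPoch_reversal_self hq0 hk
  have h2 := qPoch_reversal hq0 ht0 hk
  have hs := prod_neg_zpow_ne_zero hq0 m k
  have h3 : qPoch (q ^ (1 - (m : ℤ)) * t⁻¹) q k ≠ 0 := fun h => ht m (by rw [← h2, h]; ring)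
  simp only [qPochs, List.map_cons, List.map_nil, List.prod_cons, List.prod_nil, mul_one, bcCoeff]
  rw [← h1, ← h2]
  have := hq k
  have := hq (m - k)
  have := ht (m - k)
  field_simp

lemma bcCoeffSymm_eq {q t : ℂ} (hq0 : q ≠ 0) (ht0 : t ≠ 0) (hq : ∀ n, qPoch q q n ≠ 0)
    (ht : ∀ n, qPoch t q n ≠ 0) {A : ℂ} {m j k : ℕ} (hjk : j + k ≤ m) (hA : qPoch A q m ≠ 0)
    {b : ℂ} (hb : t * b ^ 2 = A) (u v : ℂ) :
    qPochs [t, A] q m * (qPoch (q ^ (-(m : ℤ))) q (j + k) * q ^ (j + k) / qPoch A q (j + k)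
        * (u / qPochs [q ^ (1 - (m : ℤ)) * t⁻¹, q] q j)
        * (v / qPochs [q ^ (1 - (m : ℤ)) * t⁻¹, q] q k))
      = bcCoeffSymm q t b m j k * (u * v) := by
  have h1 := qPoch_reversal_self hq0 hjk
  have h2 := qPoch_reversal hq0 ht0 (show j ≤ m by omega)
  have h2' := qPoch_reversal hq0 ht0 (show k ≤ m by omega)
  have hs := prod_neg_zpow_ne_zero hq0 m j
  have hs' := prod_neg_zpow_ne_zero hq0 m k
  have hs'' := prod_neg_zpow_ne_zero hq0 m (j + k)
  have h4 := prod_neg_zpow_mul q hq0 m j k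
  have h3 : qPoch (q ^ (1 - (m : ℤ)) * t⁻¹) q j ≠ 0 := fun h => ht m (by rw [← h2, h]; ring)
  have h3' : qPoch (q ^ (1 - (m : ℤ)) * t⁻¹) q k ≠ 0 := fun h => ht m (by rw [← h2', h]; ring)
  have h5 : qPoch A q m = qPoch A q (j + k) * qPoch (A * q ^ (j + k)) q (m - j - k) := by
    rw [← qPoch_add]; congr 1; omega
  have h6 : qPoch A q (j + k) ≠ 0 := fun h => hA (by rw [h5, h, zero_mul])
  have e1 : (q : ℂ) ^ (j * k) = (∏ i ∈ range j, -q ^ ((m : ℤ) - 1 - i))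
      * (∏ i ∈ range k, -q ^ ((m : ℤ) - 1 - i)) / ∏ i ∈ range (j + k), -q ^ ((m : ℤ) - 1 - i) :=
    eq_div_of_mul_eq hs'' h4.symm
  have hj := ht (m - j)
  have hk := ht (m - k)
  have e2 : qPoch (q ^ (1 - (m : ℤ)) * t⁻¹) q j = qPoch t q m
      / (qPoch t q (m - j) * (t ^ j * ∏ i ∈ range j, -q ^ ((m : ℤ) - 1 - i))) := by
    rw [← h2]; field_simp
  have e3 : qPoch (q ^ (1 - (m : ℤ)) * t⁻¹) q k = qPoch t q m
      / (qPoch t q (m - k) * (t ^ k * ∏ i ∈ range k, -q ^ ((m : ℤ) - 1 - i))) := by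
    rw [← h2']; field_simp
  simp only [qPochs, List.map_cons, List.map_nil, List.prod_cons, List.prod_nil, mul_one,
    bcCoeffSymm, hb, e1, e2, e3, h5]
  rw [← h1, Nat.sub_sub]
  have := hq j
  have := hq k
  have := hq (m - (j + k))
  have := ht m
  field_simp
  ring

end Coefficients

/-! ### Evaluation, signed permutations and leading coefficients of Laurent polynomials. -/

namespace LaurentPoly

variable {n : ℕ}

/-- Evaluation of Laurent polynomials at a point with nonzero coordinates. -/
noncomputable def evalHom (x : Fin n → ℂ) (hx : ∀ i, x i ≠ 0) : LaurentPoly n →ₐ[ℂ] ℂ :=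
  AddMonoidAlgebra.lift ℂ ℂ (Fin n → ℤ)
    { toFun := fun μ => ∏ i, x i ^ (μ.toAdd i)
      map_one' := by simp
      map_mul' := fun μ ν => by simp [zpow_add₀ (hx _), prod_mul_distrib] }

lemma evalHom_apply (x : Fin n → ℂ) (hx : ∀ i, x i ≠ 0) (P : LaurentPoly n) :
    evalHom x hx P = P.value x := by
  rw [evalHom, AddMonoidAlgebra.lift_apply]
  rfl

/-- The Laurent polynomial `x_i + x_i⁻¹`. -/
noncomputable def symmVar (i : Fin n) : LaurentPoly n :=
  AddMonoidAlgebra.single (Pi.single i 1) 1 + AddMonoidAlgebra.single (Pi.single i (-1)) 1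

lemma evalHom_symmVar (x : Fin n → ℂ) (hx : ∀ i, x i ≠ 0) (i : Fin n) :
    evalHom x hx (symmVar i) = x i + (x i)⁻¹ := by
  have h (c : ℤ) : ∏ j, x j ^ (Pi.single i c : Fin n → ℤ) j = x i ^ c := by
    rw [prod_eq_single i (fun j _ hj => by simp [hj]) (by simp), Pi.single_eq_same]
  rw [evalHom, symmVar, map_add, AddMonoidAlgebra.lift_single, AddMonoidAlgebra.lift_single]
  simp [h]

/-- The action of a signed permutation on exponents. -/
def signedPerm (σ : Equiv.Perm (Fin n)) (ε : Fin n → ℤˣ) : (Fin n → ℤ) →+ (Fin n → ℤ) where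
  toFun μ i := (ε i : ℤ) * μ (σ i)
  map_zero' := by ext; simp
  map_add' μ ν := by ext; simp [mul_add]

lemma signedPerm_injective (σ : Equiv.Perm (Fin n)) (ε : Fin n → ℤˣ) :
    Function.Injective (signedPerm σ ε) := by
  intro μ ν h
  ext i
  have := congrFun h (σ.symm i)
  simpa [signedPerm] using this

lemma signedPerm_single (σ : Equiv.Perm (Fin n)) (ε : Fin n → ℤˣ) (i : Fin n) (c : ℤ) :
    signedPerm σ ε (Pi.single i c) = Pi.single (σ.symm i) (ε (σ.symm i) * c) := by
  ext l
  by_cases h : l = σ.symm i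
  · subst h; simp [signedPerm]
  · have h' : σ l ≠ i := fun e => h (by rw [← e, Equiv.symm_apply_apply])
    simp [signedPerm, h, h']

/-- The algebra endomorphism of the Laurent polynomials given by a signed permutation. -/
noncomputable def signedPermHom (σ : Equiv.Perm (Fin n)) (ε : Fin n → ℤˣ) :
    LaurentPoly n →ₐ[ℂ] LaurentPoly n :=
  AddMonoidAlgebra.mapDomainAlgHom ℂ ℂ (signedPerm σ ε)

lemma signedPermHom_symmVar (σ : Equiv.Perm (Fin n)) (ε : Fin n → ℤˣ) (i : Fin n) :
    signedPermHom σ ε (symmVar i) = symmVar (σ.symm i) := by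
  simp only [signedPermHom, symmVar, map_add, AddMonoidAlgebra.mapDomainAlgHom_apply,
    AddMonoidAlgebra.mapDomain_single, signedPerm_single]
  rcases Int.units_eq_one_or (ε (σ.symm i)) with h | h <;> simp [h, add_comm]

lemma isWInvariant_of_signedPermHom {P : LaurentPoly n}
    (h : ∀ σ ε, signedPermHom σ ε P = P) : P.IsWInvariant := by
  intro σ ε μ
  have h1 : (signedPermHom σ ε P).coeff (signedPerm σ ε μ) = P.coeff μ :=
    Finsupp.mapDomain_apply (signedPerm_injective σ ε) _ _
  rw [h] at h1
  exact h1

/-- `P` has all its exponents in the box `|μ_i| ≤ d_i`, with coefficient `c` at the corner `d`. -/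
def HasCorner (P : LaurentPoly n) (d : Fin n → ℕ) (c : ℂ) : Prop :=
  (∀ μ, P.coeff μ ≠ 0 → ∀ i, |μ i| ≤ d i) ∧ P.coeff (fun i => (d i : ℤ)) = c

/-- A corner of a sum of two boxes decomposes only as corner plus corner, so a single pair of
monomials contributes there. -/
lemma HasCorner.mul {P Q : LaurentPoly n} {d e : Fin n → ℕ} {b c : ℂ} (hP : P.HasCorner d b)
    (hQ : Q.HasCorner e c) : (P * Q).HasCorner (d + e) (b * c) := by
  classical
  refine ⟨fun μ hμ i => ?_, ?_⟩
  · rw [AddMonoidAlgebra.coeff_mul] at hμ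
    obtain ⟨κ, hκ, h1⟩ := exists_ne_zero_of_sum_ne_zero hμ
    obtain ⟨ν, hν, h2⟩ := exists_ne_zero_of_sum_ne_zero h1
    have h3 : κ + ν = μ := by
      by_contra h
      exact h2 (if_neg h)
    have h4 := hP.1 κ (Finsupp.mem_support_iff.1 hκ) i
    have h5 := hQ.1 ν (Finsupp.mem_support_iff.1 hν) i
    rw [← h3, Pi.add_apply, Pi.add_apply]
    push_cast
    exact (abs_add_le _ _).trans (add_le_add h4 h5)
  · rw [AddMonoidAlgebra.coeff_mul, Finsupp.sum_eq_single (fun i => (d i : ℤ)),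
      Finsupp.sum_eq_single (fun i => (e i : ℤ)), hP.2, hQ.2, if_pos]
    · ext i; simp
    · intro ν hν hne
      refine if_neg fun h => hne ?_
      ext i
      have := congrFun h i
      simp only [Pi.add_apply] at this
      push_cast at this
      linarith
    · simp
    · intro κ hκ hne
      refine sum_eq_zero fun ν hν => if_neg fun h => hne ?_
      ext i
      have h1 := congrFun h i
      have h4 := (abs_le.1 (hP.1 κ hκ i)).2
      have h5 := (abs_le.1 (hQ.1 ν (Finsupp.mem_support_iff.1 hν) i)).2
      simp only [Pi.add_apply] at h1
      push_cast at h1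
      linarith
    · simp

lemma HasCorner.one : (1 : LaurentPoly n).HasCorner 0 1 := by
  classical
  refine ⟨fun μ hμ i => ?_, ?_⟩
  · rw [AddMonoidAlgebra.one_def, AddMonoidAlgebra.coeff_single, Finsupp.single_apply] at hμ
    rw [← (ite_ne_right_iff.1 hμ).1]
    simp
  · exact AddMonoidAlgebra.coeff_one_zero

lemma HasCorner.linear_symmVar (i : Fin n) (c B : ℂ) :
    (algebraMap ℂ (LaurentPoly n) c - B • symmVar i).HasCorner (Pi.single i 1) (-B) := by
  classical
  have e : ∀ μ, (algebraMap ℂ (LaurentPoly n) c - B • symmVar i).coeff μ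
      = (if 0 = μ then c else 0) - B * ((if Pi.single i 1 = μ then 1 else 0)
        + if Pi.single i (-1) = μ then 1 else 0) := by
    intro μ
    rw [Algebra.algebraMap_eq_smul_one, AddMonoidAlgebra.coeff_sub, Finsupp.sub_apply,
      AddMonoidAlgebra.coeff_smul_apply, AddMonoidAlgebra.coeff_smul_apply, symmVar,
      AddMonoidAlgebra.coeff_add, Finsupp.add_apply, AddMonoidAlgebra.one_def]
    simp only [AddMonoidAlgebra.coeff_single, Finsupp.single_apply, smul_eq_mul, mul_ite, mul_one,
      mul_zero]
  refine ⟨fun μ hμ j => ?_, ?_⟩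
  · rw [e] at hμ
    split_ifs at hμ with h1 h2 h3 h2 h3 h3 <;> (try subst μ) <;>
      first
      | (exfalso; simp at hμ; done)
      | (by_cases hj : j = i <;> [subst hj; skip] <;> simp [*])
  · have h : (fun l => ((Pi.single i 1 : Fin n → ℕ) l : ℤ)) = Pi.single i 1 := by
      ext l
      by_cases hl : l = i <;> [subst hl; skip] <;> simp [*]
    have h1 : (0 : Fin n → ℤ) ≠ Pi.single i 1 := fun h => by simpa using congrFun h i
    have h2 : (Pi.single i (-1) : Fin n → ℤ) ≠ Pi.single i 1 := fun h => by
      have := congrFun h i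
      simp at this
    rw [e, h, if_neg h1, if_pos rfl, if_neg h2]
    ring

lemma HasCorner.qPochSymm (q b : ℂ) (i : Fin n) (k : ℕ) :
    (qPochSymm q b (symmVar i) k).HasCorner (Pi.single i k) ((-b) ^ k * q ^ (k * (k - 1) / 2)) := by
  rw [← sum_range_id, ← prod_pow_eq_pow_sum, ← card_range k, ← prod_const, card_range,
    ← prod_mul_distrib]
  induction k with
  | zero => simpa using HasCorner.one
  | succ k ih =>
    rw [qPochSymm_succ, prod_range_succ, Pi.single_add]
    simpa only [neg_mul] using ih.mul (HasCorner.linear_symmVar i _ (b * q ^ k))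

end LaurentPoly

/-! ### The candidate polynomial: invariance, leading term, vanishing. -/

/-- The normalizing constant of `bcPoly`. -/
noncomputable def bcNorm (q t a : ℂ) (m₁ m₂ : ℕ) : ℂ :=
  q ^ (-((m₁ * (m₁ - 1) / 2 : ℕ) : ℤ) - ((m₂ * (m₂ - 1) / 2 : ℕ) : ℤ))
    / ((-t) ^ (m₁ - m₂) * a ^ (m₁ + m₂))

/-- The interpolation polynomial in two variables. -/
noncomputable def bcPoly (q t a : ℂ) (m₁ m₂ : ℕ) : LaurentPoly 2 :=
  bcNorm q t a m₁ m₂ • (qPochSymm q a (symmVar 0) m₂ * qPochSymm q a (symmVar 1) m₂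
    * bcSum q t (q ^ m₂ * a) (m₁ - m₂) (symmVar 0) (symmVar 1))

lemma bcPoly_value (q t a : ℂ) (m₁ m₂ : ℕ) (x : Fin 2 → ℂ) (hx : ∀ i, x i ≠ 0) :
    (bcPoly q t a m₁ m₂).value x
      = bcNorm q t a m₁ m₂ * (qPochSymm q a (x 0 + (x 0)⁻¹) m₂ * qPochSymm q a (x 1 + (x 1)⁻¹) m₂
        * bcSum q t (q ^ m₂ * a) (m₁ - m₂) (x 0 + (x 0)⁻¹) (x 1 + (x 1)⁻¹)) := by
  rw [← evalHom_apply x hx, bcPoly, map_smul, map_mul, map_mul, map_qPochSymm, map_qPochSymm,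
    map_bcSum, evalHom_symmVar, evalHom_symmVar, smul_eq_mul]

lemma bcPoly_isWInvariant {q : ℂ} (hq : ∀ n, qPoch q q n ≠ 0) (t a : ℂ) (m₁ m₂ : ℕ) :
    (bcPoly q t a m₁ m₂).IsWInvariant := by
  refine isWInvariant_of_signedPermHom fun σ ε => ?_
  rw [bcPoly, map_smul, map_mul, map_mul, map_qPochSymm, map_qPochSymm, map_bcSum,
    signedPermHom_symmVar, signedPermHom_symmVar]
  have h : σ.symm 0 ≠ σ.symm 1 := fun h => by simpa using σ.symm.injective h
  obtain ⟨h0, h1⟩ | ⟨h0, h1⟩ : (σ.symm 0 = 0 ∧ σ.symm 1 = 1) ∨ (σ.symm 0 = 1 ∧ σ.symm 1 = 0) := by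
    omega
  · rw [h0, h1]
  · rw [h0, h1, bcSum_comm hq, mul_comm (qPochSymm q a (symmVar 1) m₂)]

lemma bcPoly_eq_sum (q t a : ℂ) (m₁ m₂ : ℕ) :
    bcPoly q t a m₁ m₂ = ∑ k ∈ range (m₁ - m₂ + 1), (bcNorm q t a m₁ m₂ * bcCoeff q t (m₁ - m₂) k) •
      (qPochSymm q a (symmVar 0) m₂ * qPochSymm q a (symmVar 1) m₂
        * (qPochSymm q (t * q ^ k * (q ^ m₂ * a)) (symmVar 0) (m₁ - m₂ - k)
          * qPochSymm q (q ^ m₂ * a) (symmVar 1) k)) := by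
  rw [bcPoly, bcSum, mul_sum, smul_sum]
  exact sum_congr rfl fun k _ => by rw [mul_smul_comm, smul_smul]

lemma bcPoly_term_hasCorner (q t a : ℂ) {m₁ m₂ k : ℕ} (h : m₂ ≤ m₁) (hk : k ≤ m₁ - m₂) :
    (qPochSymm q a (symmVar 0) m₂ * qPochSymm q a (symmVar 1) m₂
        * (qPochSymm q (t * q ^ k * (q ^ m₂ * a)) (symmVar 0) (m₁ - m₂ - k)
          * qPochSymm q (q ^ m₂ * a) (symmVar 1) k) : LaurentPoly 2).HasCorner ![m₁ - k, m₂ + k]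
      (((-a) ^ m₂ * q ^ (m₂ * (m₂ - 1) / 2)) * ((-a) ^ m₂ * q ^ (m₂ * (m₂ - 1) / 2))
        * (((-(t * q ^ k * (q ^ m₂ * a))) ^ (m₁ - m₂ - k)
            * q ^ ((m₁ - m₂ - k) * ((m₁ - m₂ - k) - 1) / 2))
          * ((-(q ^ m₂ * a)) ^ k * q ^ (k * (k - 1) / 2)))) := by
  convert ((HasCorner.qPochSymm q a 0 m₂).mul (HasCorner.qPochSymm q a 1 m₂)).mul
    ((HasCorner.qPochSymm q (t * q ^ k * (q ^ m₂ * a)) 0 (m₁ - m₂ - k)).mul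
      (HasCorner.qPochSymm q (q ^ m₂ * a) 1 k)) using 1
  ext i
  fin_cases i <;> simp
  omega

lemma bcPoly_support (q t a : ℂ) {m₁ m₂ : ℕ} (h : m₂ ≤ m₁) {μ : Fin 2 → ℤ}
    (hμ : (bcPoly q t a m₁ m₂).coeff μ ≠ 0) :
    (μ 0).natAbs + (μ 1).natAbs ≤ m₁ + m₂ ∧ (μ 0).natAbs ≤ m₁ ∧ (μ 1).natAbs ≤ m₁ := by
  rw [bcPoly_eq_sum, AddMonoidAlgebra.coeff_sum, Finsupp.finsetSum_apply] at hμ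
  obtain ⟨k, hk, h1⟩ := exists_ne_zero_of_sum_ne_zero hμ
  rw [AddMonoidAlgebra.coeff_smul_apply] at h1
  have hk' : k ≤ m₁ - m₂ := Nat.lt_succ_iff.1 (mem_range.1 hk)
  have h2 := (bcPoly_term_hasCorner q t a h hk').1 μ (right_ne_zero_of_mul h1)
  have h3 := h2 0
  have h4 := h2 1
  simp only [Matrix.cons_val_zero, Matrix.cons_val_one, Int.abs_eq_natAbs] at h3 h4
  omega

/-- Splits the exponent of `q` in `bcNorm` to match the corner coefficient of the `k = 0` term. -/
lemma triangle_add (m r : ℕ) :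
    (m + r) * (m + r - 1) / 2 = m * (m - 1) / 2 + m * r + r * (r - 1) / 2 := by
  rw [← sum_range_id, ← sum_range_id, ← sum_range_id, sum_range_add, sum_add_distrib]
  simp [mul_comm, add_assoc]

lemma bcPoly_coeff_self {q t a : ℂ} (hq0 : q ≠ 0) (ht0 : t ≠ 0) (ha0 : a ≠ 0)
    (hq : ∀ n, qPoch q q n ≠ 0) (ht : ∀ n, qPoch t q n ≠ 0) {m₁ m₂ : ℕ} (h : m₂ ≤ m₁) :
    (bcPoly q t a m₁ m₂).coeff ![(m₁ : ℤ), (m₂ : ℤ)] = 1 := by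
  rw [bcPoly_eq_sum, AddMonoidAlgebra.coeff_sum, Finsupp.finsetSum_apply,
    sum_eq_single_of_mem 0 (by simp)]
  · have h1 := (bcPoly_term_hasCorner q t a h (Nat.zero_le _)).2
    have e : (fun i => ((![m₁ - 0, m₂ + 0] : Fin 2 → ℕ) i : ℤ)) = ![(m₁ : ℤ), (m₂ : ℤ)] := by
      ext i; fin_cases i <;> simp
    rw [e] at h1
    rw [AddMonoidAlgebra.coeff_smul_apply, h1]
    obtain ⟨r, rfl⟩ := Nat.exists_eq_add_of_le h
    simp only [bcNorm, bcCoeff, Nat.add_sub_cancel_left, triangle_add, Nat.sub_zero, pow_zero,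
      qPoch_zero, mul_one, one_mul, smul_eq_mul, Nat.zero_sub, Nat.mul_zero, Nat.zero_div]
    rw [div_self (hq r), div_self (ht r)]
    generalize m₂ * (m₂ - 1) / 2 = u
    generalize r * (r - 1) / 2 = v
    rw [← neg_add', zpow_neg]
    norm_cast
    have : (-t) ≠ 0 := neg_ne_zero.2 ht0
    rw [show -(t * (q ^ m₂ * a)) = (-t) * (q ^ m₂ * a) by ring, mul_pow (-t), mul_pow (q ^ m₂),
      show (-a) ^ m₂ * q ^ u * ((-a) ^ m₂ * q ^ u) = (a ^ m₂) ^ 2 * (q ^ u) ^ 2 by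
        rw [neg_pow]; ring_nf; rw [pow_mul _ m₂ 2]; simp]
    field_simp
    ring
  -- For `k > 0` the box has first side `m₁ - k < m₁`, so it misses the leading exponent.
  · intro k hk hk0
    have hk' : k ≤ m₁ - m₂ := Nat.lt_succ_iff.1 (mem_range.1 hk)
    by_contra hne
    rw [AddMonoidAlgebra.coeff_smul_apply] at hne
    have h2 := (bcPoly_term_hasCorner q t a h hk').1 _ (right_ne_zero_of_mul hne) 0
    simp only [Matrix.cons_val_zero, Nat.abs_cast] at h2
    omega

lemma bcPoly_vanishing {q t a : ℂ} (hq0 : q ≠ 0) (ht0 : t ≠ 0) (ha0 : a ≠ 0) {m₁ m₂ μ₁ μ₂ : ℕ}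
    (hμ : μ₂ ≤ μ₁) (hlt : μ₁ < m₁ ∨ μ₂ < m₂) (x : Fin 2 → ℂ) (hx0 : x 0 = q ^ μ₁ * t * a)
    (hx1 : x 1 = q ^ μ₂ * a) : (bcPoly q t a m₁ m₂).value x = 0 := by
  have hx0' : x 0 ≠ 0 := by rw [hx0]; positivity
  have hx1' : x 1 ≠ 0 := by rw [hx1]; positivity
  rw [bcPoly_value q t a m₁ m₂ x (fun i => by fin_cases i <;> assumption), bcSum]
  simp only [qPochSymm_complex q _ hx0', qPochSymm_complex q _ hx1']
  by_cases h2 : μ₂ < m₂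
  · rw [qPoch_eq_zero (b := a * (x 1)⁻¹) h2 (by rw [hx1]; field_simp)]
    ring
  · rw [sum_eq_zero]
    · ring
    · intro k hk
      have hk' : k ≤ m₁ - m₂ := Nat.lt_succ_iff.1 (mem_range.1 hk)
      -- If `m₂ + k ≤ μ₁ < m₁`, the first-variable factor `(q^(m₂+k-μ₁); q)_(m₁-m₂-k)` vanishes.
      -- Otherwise `m₂ ≤ μ₂ ≤ μ₁ < m₂ + k`, and `(q^(m₂-μ₂); q)_k` vanishes.
      by_cases h1 : m₂ + k ≤ μ₁
      · obtain ⟨l, rfl⟩ := Nat.exists_eq_add_of_le h1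
        rw [qPoch_eq_zero (b := t * q ^ k * (q ^ m₂ * a) * (x 0)⁻¹) (j := l) (by omega)
          (by rw [hx0]; field_simp; ring)]
        simp
      · obtain ⟨l, rfl⟩ := Nat.exists_eq_add_of_le (not_lt.1 h2)
        rw [qPoch_eq_zero (b := q ^ m₂ * a * (x 1)⁻¹) (j := l) (by omega)
          (by rw [hx1]; field_simp; ring)]
        simp

lemma bcPoly_value_self_ne_zero {q t : ℝ} (hq0 : 0 < q) (hq1 : q < 1) (ht0 : 0 < t) (ht1 : t < 1)
    {a : ℂ} (ha0 : a ≠ 0)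
    (ha : ∀ i j : ℕ, 1 ≤ i → (q : ℂ) ^ i * (t : ℂ) ^ j * a ^ 2 ≠ 1)
    (hq : ∀ n, qPoch (q : ℂ) q n ≠ 0) (ht : ∀ n, qPoch (t : ℂ) q n ≠ 0)
    {m₁ m₂ : ℕ} (h : m₂ ≤ m₁) (x : Fin 2 → ℂ) (hx0 : x 0 = q ^ m₁ * t * a)
    (hx1 : x 1 = q ^ m₂ * a) : (bcPoly q t a m₁ m₂).value x ≠ 0 := by
  have hqc : (q : ℂ) ≠ 0 := by exact_mod_cast hq0.ne'
  have htc : (t : ℂ) ≠ 0 := by exact_mod_cast ht0.ne'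
  have hx0' : x 0 ≠ 0 := by rw [hx0]; positivity
  have hx1' : x 1 ≠ 0 := by rw [hx1]; positivity
  rw [bcPoly_value q t a m₁ m₂ x (fun i => by fin_cases i <;> assumption), bcSum,
    sum_eq_single_of_mem 0 (by simp)]
  swap
  · intro k _ hk
    rw [qPochSymm_complex q _ hx1', qPoch_eq_zero (b := q ^ m₂ * a * (x 1)⁻¹) (j := 0)
      (Nat.pos_of_ne_zero hk) (by rw [hx1]; field_simp)]
    simp
  simp only [qPochSymm_complex _ _ hx0', qPochSymm_complex _ _ hx1', pow_zero, mul_one,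
    qPoch_zero, Nat.sub_zero, smul_eq_mul]
  have hpow {i j : ℕ} (hij : i < j) : (q : ℂ) ^ i ≠ q ^ j := fun e => by
    have : q ^ i = q ^ j := by exact_mod_cast e
    exact (pow_lt_pow_right_of_lt_one₀ hq0 hq1 hij).ne' this
  have hdiv {y z : ℂ} (hz : z ≠ 0) (hyz : y ≠ z) : y * z⁻¹ ≠ 1 := by
    rwa [← div_eq_mul_inv, Ne, div_eq_one_iff_eq hz]
  refine mul_ne_zero ?_ (mul_ne_zero (mul_ne_zero (mul_ne_zero ?_ ?_) (mul_ne_zero ?_ ?_))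
    (mul_ne_zero ?_ (mul_ne_zero ?_ ?_)))
  · rw [bcNorm]
    have : (-t : ℂ) ≠ 0 := neg_ne_zero.2 htc
    positivity
  · refine qPoch_ne_zero fun j hj => ?_
    convert ha (m₁ + j) 1 (by omega) using 1
    rw [hx0]; ring
  · refine qPoch_ne_zero fun j hj => ?_
    rw [mul_right_comm]
    refine hdiv hx0' ?_
    rw [hx0]
    intro e
    have e' : (q : ℂ) ^ j = q ^ m₁ * t := mul_left_cancel₀ ha0 (by linear_combination e)
    have e'' : q ^ j = q ^ m₁ * t := by exact_mod_cast e'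
    have h1 : q ^ m₁ ≤ q ^ j := pow_le_pow_of_le_one hq0.le hq1.le (by omega)
    have h2 : q ^ m₁ * t < q ^ m₁ := mul_lt_of_lt_one_right (by positivity) ht1
    linarith
  · refine qPoch_ne_zero fun j hj => ?_
    convert ha (m₂ + j) 0 (by omega) using 1
    rw [hx1]; ring
  · refine qPoch_ne_zero fun j hj => ?_
    rw [mul_right_comm]
    refine hdiv hx1' ?_
    rw [hx1]
    exact fun e => hpow hj (mul_left_cancel₀ ha0 (by linear_combination e))
  · simp only [bcCoeff, Nat.sub_zero, pow_zero, qPoch_zero, one_mul]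
    rw [div_self (hq _), div_self (ht _), one_mul]
    exact one_ne_zero
  · refine qPoch_ne_zero fun j hj => ?_
    convert ha (m₁ + m₂ + j) 2 (by omega) using 1
    rw [hx0]; ring
  · refine qPoch_ne_zero fun j hj => ?_
    rw [mul_right_comm]
    refine hdiv hx0' ?_
    rw [hx0]
    refine fun e => hpow (i := m₂ + j) (j := m₁) (by omega) (mul_left_cancel₀ (mul_ne_zero htc ha0) ?_)
    linear_combination e

/-! ### Orbits of exponents under signed permutations. -/

namespace LaurentPoly

/-- A statistic whose values determine the signed-permutation orbit of an exponent. -/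
def orbitCode (μ : Fin 2 → ℤ) : ℕ :=
  ((μ 0).natAbs + (μ 1).natAbs) ^ 2 + max (μ 0).natAbs (μ 1).natAbs

/-- The dominant representative of the signed-permutation orbit of an exponent. -/
def dominant (μ : Fin 2 → ℤ) : ℕ × ℕ :=
  (max (μ 0).natAbs (μ 1).natAbs, min (μ 0).natAbs (μ 1).natAbs)

lemma IsWInvariant.coeff_dominant {P : LaurentPoly 2} (hP : P.IsWInvariant) (μ : Fin 2 → ℤ) :
    P.coeff μ = P.coeff ![((dominant μ).1 : ℤ), ((dominant μ).2 : ℤ)] := by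
  have h (σ : Equiv.Perm (Fin 2)) : P.coeff (fun i => ((μ (σ i)).natAbs : ℤ)) = P.coeff μ := by
    refine Eq.trans ?_ (hP σ (fun i => if 0 ≤ μ (σ i) then 1 else -1) μ)
    rw [coefficient]
    congr 1
    ext i
    split_ifs with h0
    · simpa using h0
    · simpa using (not_le.1 h0).le
  by_cases h01 : (μ 1).natAbs ≤ (μ 0).natAbs
  · rw [← h 1]
    congr 1
    ext i
    fin_cases i <;> simp [dominant, h01]
  · rw [← h (Equiv.swap 0 1)]
    congr 1
    ext i
    have := le_of_not_ge h01
    fin_cases i <;> simp [dominant, this]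

/-- The code is `s² + m` with `m ≤ s`, hence lies in `[s², (s+1)²)`. So `s` is recoverable, then the
maximum `m`, then the minimum `s - m`. -/
lemma dominant_eq_of_orbitCode_eq {μ ν : Fin 2 → ℤ} (h : orbitCode μ = orbitCode ν) :
    dominant μ = dominant ν := by
  have key {s s' m m' : ℕ} (hm : m ≤ s) (hm' : m' ≤ s') (h : s ^ 2 + m = s' ^ 2 + m') : s = s' := by
    rcases lt_trichotomy s s' with hlt | heq | hlt
    · nlinarith
    · exact heq
    · nlinarith
  have hs := key (by omega) (by omega) h
  rw [orbitCode, orbitCode, hs] at h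
  rw [dominant, dominant, Prod.mk.injEq]
  omega

/-- Degree only bounds signed exponent sums; invariance moves the exponent to its dominant
representative, whose sum is `|μ₀| + |μ₁|`. -/
lemma HasDegree.natAbs_le {P : LaurentPoly 2} (hP : P.IsWInvariant) {d : ℕ}
    (hd : P.HasDegree (d : ℤ)) {μ : Fin 2 → ℤ} (hμ : P.coeff μ ≠ 0) :
    (μ 0).natAbs + (μ 1).natAbs ≤ d := by
  rw [hP.coeff_dominant] at hμ
  have := hd.2 ⟨_, hμ, rfl⟩
  simp only [Fin.sum_univ_two, Matrix.cons_val_zero, Matrix.cons_val_one, dominant] at this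
  omega

end LaurentPoly

/-! ### Triangularity and uniqueness. -/

section Uniqueness

variable {q t : ℝ} {a : ℂ}

lemma bcPoly_orbitCode_le (q t a : ℂ) {m₁ m₂ : ℕ} (h : m₂ ≤ m₁) {μ : Fin 2 → ℤ}
    (hμ : (bcPoly q t a m₁ m₂).coeff μ ≠ 0) : orbitCode μ ≤ orbitCode ![(m₁ : ℤ), (m₂ : ℤ)] := by
  obtain ⟨h1, h2, h3⟩ := bcPoly_support q t a h hμ
  simp only [orbitCode, Matrix.cons_val_zero, Matrix.cons_val_one, Int.natAbs_natCast]
  exact add_le_add (Nat.pow_le_pow_left (by omega) 2) (by omega)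

/-- Each code value belongs to at most one orbit, so subtracting one multiple of a monic `bcPoly`
removes the top orbit and lowers the bound. -/
theorem exists_bcPoly_expansion {q t a : ℂ} (hq0 : q ≠ 0) (ht0 : t ≠ 0) (ha0 : a ≠ 0)
    (hq : ∀ n, qPoch q q n ≠ 0) (ht : ∀ n, qPoch t q n ≠ 0) (n : ℕ) (D : LaurentPoly 2)
    (hD : D.IsWInvariant) (hn : ∀ μ, D.coeff μ ≠ 0 → orbitCode μ < n) :
    ∃ c : ℕ × ℕ →₀ ℂ, (∀ p ∈ c.support, p.2 ≤ p.1 ∧ orbitCode ![(p.1 : ℤ), (p.2 : ℤ)] < n) ∧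
      D = c.sum fun p z => z • bcPoly q t a p.1 p.2 := by
  classical
  induction n generalizing D with
  | zero =>
    refine ⟨0, by simp, ?_⟩
    ext μ
    simpa using hn μ
  | succ n ih =>
    by_cases hex : ∃ μ, D.coeff μ ≠ 0 ∧ orbitCode μ = n
    · obtain ⟨μ, hμ, hcode⟩ := hex
      set p := dominant μ with hp
      have hle : p.2 ≤ p.1 := by rw [hp]; simp [dominant]
      set ν : Fin 2 → ℤ := ![(p.1 : ℤ), (p.2 : ℤ)] with hν
      have hνcode : orbitCode ν = n := by
        rw [← hcode]
        simp only [hν, orbitCode, hp, dominant, Matrix.cons_val_zero, Matrix.cons_val_one,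
          Int.natAbs_natCast, max_add_min]
        simp
      have hinv := bcPoly_isWInvariant hq t a p.1 p.2
      have hD' : (D - D.coeff ν • bcPoly q t a p.1 p.2).IsWInvariant := fun σ ε κ => by
        have h1 := hD σ ε κ
        have h2 := hinv σ ε κ
        simp only [LaurentPoly.coefficient, AddMonoidAlgebra.coeff_sub, Finsupp.sub_apply,
          AddMonoidAlgebra.coeff_smul_apply] at h1 h2 ⊢
        rw [h1, h2]
      obtain ⟨c, hc, hsum⟩ := ih _ hD' fun κ hκ => by
        refine lt_of_le_of_ne ?_ fun hκn => ?_
        · by_contra hlt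
          refine hκ ?_
          have h1 : D.coeff κ = 0 := by
            by_contra h
            have := hn κ h
            omega
          have h2 : (bcPoly q t a p.1 p.2).coeff κ = 0 := by
            by_contra h
            have := bcPoly_orbitCode_le q t a hle h
            rw [← hν] at this
            omega
          rw [AddMonoidAlgebra.coeff_sub, Finsupp.sub_apply, AddMonoidAlgebra.coeff_smul_apply, h1,
            h2, smul_zero, sub_zero]
        · rw [hD'.coeff_dominant, dominant_eq_of_orbitCode_eq (hκn.trans hcode.symm), ← hp, ← hν,
            AddMonoidAlgebra.coeff_sub, Finsupp.sub_apply, AddMonoidAlgebra.coeff_smul_apply,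
            hν, bcPoly_coeff_self hq0 ht0 ha0 hq ht hle] at hκ
          simp at hκ
      refine ⟨c + Finsupp.single p (D.coeff ν), fun r hr => ?_, ?_⟩
      · rcases mem_union.1 (Finsupp.support_add hr) with h | h
        · exact ⟨(hc r h).1, (hc r h).2.trans (Nat.lt_succ_self n)⟩
        · obtain rfl := mem_singleton.1 (Finsupp.support_single_subset h)
          exact ⟨hle, by rw [← hν]; omega⟩
      · rw [Finsupp.sum_add_index' (by simp) (by simp [add_smul]), ← hsum,
          Finsupp.sum_single_index (by simp), sub_add_cancel]
    · obtain ⟨c, hc, hsum⟩ := ih D hD fun μ hμ =>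
        lt_of_le_of_ne (Nat.lt_succ_iff.1 (hn μ hμ)) fun h => hex ⟨μ, hμ, h⟩
      exact ⟨c, fun p hp => ⟨(hc p hp).1, (hc p hp).2.trans (Nat.lt_succ_self n)⟩, hsum⟩

lemma qPoch_ofReal_ne_zero (hq0 : 0 < q) (hq1 : q < 1) {b : ℝ} (hb1 : b < 1) (hb0 : 0 < b) (n : ℕ) :
    qPoch (b : ℂ) q n ≠ 0 := by
  refine qPoch_ne_zero fun j _ e => ?_
  have e' : b * q ^ j = 1 := by exact_mod_cast e
  have : b * q ^ j ≤ b := mul_le_of_le_one_right hb0.le (pow_le_one₀ hq0.le hq1.le)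
  linarith

lemma bcPoly_isBCInterpolation (hq0 : 0 < q) (hq1 : q < 1) (ht0 : 0 < t) (ht1 : t < 1)
    (ha0 : a ≠ 0) {m₁ m₂ : ℕ} (h : m₂ ≤ m₁) :
    IsBCInterpolation q t a ![m₁, m₂] (bcPoly q t a m₁ m₂) := by
  have hqc : (q : ℂ) ≠ 0 := by exact_mod_cast hq0.ne'
  have htc : (t : ℂ) ≠ 0 := by exact_mod_cast ht0.ne'
  have hq := qPoch_ofReal_ne_zero hq0 hq1 hq1 hq0
  have ht := qPoch_ofReal_ne_zero hq0 hq1 ht1 ht0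
  have e : (fun i => ((![m₁, m₂] : Fin 2 → ℕ) i : ℤ)) = ![(m₁ : ℤ), (m₂ : ℤ)] := by
    ext i; fin_cases i <;> simp
  have hself := bcPoly_coeff_self hqc htc ha0 hq ht h
  refine ⟨bcPoly_isWInvariant hq _ _ _ _, ⟨?_, ?_⟩, ?_, ?_⟩
  · refine ⟨![(m₁ : ℤ), (m₂ : ℤ)], ?_, by rw [← e]⟩
    rw [coefficient, hself]
    exact one_ne_zero
  · rintro _ ⟨μ, hμ, rfl⟩
    have := (bcPoly_support q t a h hμ).1
    simp only [Fin.sum_univ_two, Matrix.cons_val_zero, Matrix.cons_val_one]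
    omega
  · rw [e]
    exact hself
  · intro μ hμ hle
    refine bcPoly_vanishing hqc htc ha0 (μ₁ := μ 0) (μ₂ := μ 1) (hμ (by decide)) ?_ _
      (by simp) (by simp)
    by_contra! hcon
    refine hle fun i => ?_
    fin_cases i
    · exact hcon.1
    · exact hcon.2

theorem IsBCInterpolation.eq_bcPoly (hq0 : 0 < q) (hq1 : q < 1) (ht0 : 0 < t) (ht1 : t < 1)
    (ha0 : a ≠ 0) (ha : ∀ i j : ℕ, 1 ≤ i → (q : ℂ) ^ i * (t : ℂ) ^ j * a ^ 2 ≠ 1)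
    {m₁ m₂ : ℕ} (h : m₂ ≤ m₁) {P : LaurentPoly 2} (hP : IsBCInterpolation q t a ![m₁, m₂] P) :
    P = bcPoly q t a m₁ m₂ := by
  have hqc : (q : ℂ) ≠ 0 := by exact_mod_cast hq0.ne'
  have htc : (t : ℂ) ≠ 0 := by exact_mod_cast ht0.ne'
  have hq := qPoch_ofReal_ne_zero hq0 hq1 hq1 hq0
  have ht := qPoch_ofReal_ne_zero hq0 hq1 ht1 ht0
  have hQ := bcPoly_isBCInterpolation hq0 hq1 ht0 ht1 ha0 h
  rw [← sub_eq_zero]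
  set D := P - bcPoly q t a m₁ m₂ with hD
  have hcoeff (μ) : D.coeff μ = P.coeff μ - (bcPoly q t a m₁ m₂).coeff μ := by
    rw [hD, AddMonoidAlgebra.coeff_sub, Finsupp.sub_apply]
  have hdeg : ∑ i, ((![m₁, m₂] : Fin 2 → ℕ) i : ℤ) = ((m₁ + m₂ : ℕ) : ℤ) := by simp
  have hinv : D.IsWInvariant := fun σ ε μ => by
    have h1 := hP.invariant σ ε μ
    have h2 := hQ.invariant σ ε μ
    simp only [coefficient, hcoeff] at h1 h2 ⊢
    rw [h1, h2]
  have hsupp (μ) (hμ : D.coeff μ ≠ 0) : (μ 0).natAbs + (μ 1).natAbs ≤ m₁ + m₂ := by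
    by_contra hlt
    have hPd := hP.degree
    have hQd := hQ.degree
    rw [hdeg] at hPd hQd
    refine hμ ?_
    rw [hcoeff, not_not.1 fun h1 => hlt (hPd.natAbs_le hP.invariant h1),
      not_not.1 fun h1 => hlt (hQd.natAbs_le hQ.invariant h1), sub_zero]
  -- A code is below `(m₁ + m₂ + 1)²` exactly when `|μ₀| + |μ₁| ≤ m₁ + m₂`, so the degree bound
  -- passes to the indices of the expansion.
  obtain ⟨c, hc, hsum⟩ := exists_bcPoly_expansion hqc htc ha0 hq ht ((m₁ + m₂ + 1) ^ 2) D hinv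
    fun μ hμ => by
      have h1 := hsupp μ hμ
      have h2 : max (μ 0).natAbs (μ 1).natAbs ≤ m₁ + m₂ := by omega
      have h3 := Nat.pow_le_pow_left h1 2
      rw [orbitCode]
      nlinarith
  have hcdeg (p) (hp : p ∈ c.support) : p.1 + p.2 ≤ m₁ + m₂ := by
    have h1 := (hc p hp).2
    simp only [orbitCode, Matrix.cons_val_zero, Matrix.cons_val_one, Int.natAbs_natCast] at h1
    have h2 : (p.1 + p.2) ^ 2 < (m₁ + m₂ + 1) ^ 2 := by omega
    exact Nat.lt_succ_iff.1 (lt_of_pow_lt_pow_left₀ 2 (Nat.zero_le _) h2)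
  set pt : ℕ × ℕ → Fin 2 → ℂ :=
    fun p i => (q : ℂ) ^ (![p.1, p.2] : Fin 2 → ℕ) i * (t : ℂ) ^ (2 - 1 - (i : ℕ)) * a with hpt
  have hpt0 (p) : pt p 0 = q ^ p.1 * t * a := by simp [hpt]
  have hpt1 (p) : pt p 1 = q ^ p.2 * a := by simp [hpt]
  have hptne (p i) : pt p i ≠ 0 := by simp only [hpt]; positivity
  -- Any other index has size at least `|p|`, so it is not contained in `p` and its polynomial
  -- vanishes at the node of `p`. Thus `D` is nonzero there, which forces `λ ⊆ p`; equality follows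
  -- since `|p| ≤ |λ|`.
  have hmin (p) (hp : p ∈ c.support) (hpm : ∀ r ∈ c.support, p.1 + p.2 ≤ r.1 + r.2) :
      p = (m₁, m₂) := by
    have hval : D.value (pt p) = c p * (bcPoly q t a p.1 p.2).value (pt p) := by
      rw [← evalHom_apply _ (hptne p), hsum, Finsupp.sum, map_sum, sum_eq_single_of_mem p hp,
        map_smul, evalHom_apply, smul_eq_mul]
      intro r hr hrp
      rw [map_smul, evalHom_apply, bcPoly_vanishing hqc htc ha0 (hc p hp).1 ?_ _ (hpt0 p) (hpt1 p),
        smul_zero]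
      have := hpm r hr
      by_contra! hcon
      exact hrp (Prod.ext (by omega) (by omega))
    have hne : D.value (pt p) ≠ 0 := by
      rw [hval]
      exact mul_ne_zero (Finsupp.mem_support_iff.1 hp) (bcPoly_value_self_ne_zero hq0 hq1 ht0 ht1
        ha0 ha hq ht (hc p hp).1 _ (hpt0 p) (hpt1 p))
    have hle : (![m₁, m₂] : Fin 2 → ℕ) ≤ ![p.1, p.2] := by
      by_contra hle
      have hanti : Antitone (![p.1, p.2] : Fin 2 → ℕ) := by
        intro i j hij
        have := (hc p hp).1
        fin_cases i <;> fin_cases j <;> simp_all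
      refine hne ?_
      rw [← evalHom_apply _ (hptne p), hD, map_sub, evalHom_apply, evalHom_apply]
      have h1 := hP.vanishing _ hanti hle
      have h2 := hQ.vanishing _ hanti hle
      rw [show P.value (pt p) = 0 from h1, show (bcPoly q t a m₁ m₂).value (pt p) = 0 from h2,
        sub_zero]
    have h0 : m₁ ≤ p.1 := hle 0
    have h1 : m₂ ≤ p.2 := hle 1
    have h2 := hcdeg p hp
    exact Prod.ext (by dsimp only; omega) (by dsimp only; omega)
  by_contra hne
  have hcne : c.support.Nonempty := by
    rw [Finsupp.support_nonempty_iff]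
    rintro rfl
    exact hne (by rw [hsum, Finsupp.sum_zero_index])
  obtain ⟨p, hp, hpm⟩ := exists_min_image c.support (fun r => r.1 + r.2) hcne
  obtain rfl := hmin p hp hpm
  -- The minimal size is already the maximal one, `m₁ + m₂`, so every index in the support is
  -- minimal.
  have hall (r) (hr : r ∈ c.support) : r = (m₁, m₂) :=
    hmin r hr fun s hs => (hcdeg r hr).trans (hpm s hs)
  have hlead : D.coeff ![(m₁ : ℤ), (m₂ : ℤ)] = c (m₁, m₂) := by
    rw [hsum, Finsupp.sum, AddMonoidAlgebra.coeff_sum, Finsupp.finsetSum_apply,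
      sum_eq_single_of_mem _ hp (fun r hr hrp => absurd (hall r hr) hrp),
      AddMonoidAlgebra.coeff_smul_apply, bcPoly_coeff_self hqc htc ha0 hq ht h, smul_eq_mul, mul_one]
  have e : (fun i => ((![m₁, m₂] : Fin 2 → ℕ) i : ℤ)) = ![(m₁ : ℤ), (m₂ : ℤ)] := by
    ext i; fin_cases i <;> simp
  have h1 := hP.monic
  have h2 := hQ.monic
  rw [e, coefficient] at h1 h2
  rw [hcoeff, h1, h2, sub_self] at hlead
  exact Finsupp.mem_support_iff.1 hp hlead.symm

end Uniqueness

/-! ### The explicit formulas. -/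

lemma bc2Prefactor_eq (q t a : ℂ) (m₁ m₂ : ℕ) {x₁ x₂ : ℂ} (hx₁ : x₁ ≠ 0) (hx₂ : x₂ ≠ 0) :
    bc2Prefactor q t a m₁ m₂ x₁ x₂ = bcNorm q t a m₁ m₂
      * (qPochSymm q a (x₁ + x₁⁻¹) m₂ * qPochSymm q a (x₂ + x₂⁻¹) m₂) := by
  rw [bc2Prefactor, bcNorm, qPochSymm_complex q a hx₁, qPochSymm_complex q a hx₂]
  simp [qPochs, mul_assoc]

lemma qPochs_pair (u v q : ℂ) (k : ℕ) : qPochs [u, v] q k = qPoch u q k * qPoch v q k := by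
  simp [qPochs]

theorem mainTheorem6 (q t : ℝ) (hq0 : 0 < q) (hq1 : q < 1) (ht0 : 0 < t) (ht1 : t < 1)
    (a : ℂ) (ha0 : a ≠ 0)
    (ha : ∀ i j : ℕ, 1 ≤ i → (q : ℂ) ^ i * (t : ℂ) ^ j * a ^ 2 ≠ 1)
    (m₁ m₂ : ℕ) (hm : m₂ ≤ m₁) :
    (∃! P : LaurentPoly 2, IsBCInterpolation q t a ![m₁, m₂] P) ∧
    ∀ P : LaurentPoly 2, IsBCInterpolation q t a ![m₁, m₂] P →
      ∀ x₁ x₂ : ℂ, x₁ ≠ 0 → x₂ ≠ 0 →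
        -- the `₄φ₃` is balanced: `q` times the upper parameters equals the lower parameters
        ((q : ℂ) * ((q : ℂ) ^ (-((m₁ - m₂ : ℕ) : ℤ)) * t
            * ((q : ℂ) ^ m₂ * a * x₂) * ((q : ℂ) ^ m₂ * a * x₂⁻¹))
          = ((q : ℂ) ^ (1 - ((m₁ - m₂ : ℕ) : ℤ)) * (t : ℂ)⁻¹)
            * ((q : ℂ) ^ m₂ * t * a * x₁) * ((q : ℂ) ^ m₂ * t * a * x₁⁻¹)) ∧
        -- the formula with the `₄φ₃`, where none of its denominators vanishes
        (qPochs [(q : ℂ) ^ m₂ * t * a * x₁, (q : ℂ) ^ m₂ * t * a * x₁⁻¹] q (m₁ - m₂) ≠ 0 →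
          P.value ![x₁, x₂] =
            bc2Prefactor q t a m₁ m₂ x₁ x₂
              * qPochs [(q : ℂ) ^ m₂ * t * a * x₁, (q : ℂ) ^ m₂ * t * a * x₁⁻¹] q (m₁ - m₂)
              * phi43 (m₁ - m₂) t ((q : ℂ) ^ m₂ * a * x₂) ((q : ℂ) ^ m₂ * a * x₂⁻¹)
                  ((q : ℂ) ^ (1 - ((m₁ - m₂ : ℕ) : ℤ)) * (t : ℂ)⁻¹)
                  ((q : ℂ) ^ m₂ * t * a * x₁) ((q : ℂ) ^ m₂ * t * a * x₁⁻¹) q q) ∧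
        -- the same formula with the product multiplied into the series, at every point
        (P.value ![x₁, x₂] =
          bc2Prefactor q t a m₁ m₂ x₁ x₂
            * ∑ k ∈ Finset.range (m₁ - m₂ + 1),
                qPochs [(q : ℂ) ^ (-((m₁ - m₂ : ℕ) : ℤ)), (t : ℂ)] q k * (q : ℂ) ^ k
                  / qPochs [(q : ℂ) ^ (1 - ((m₁ - m₂ : ℕ) : ℤ)) * (t : ℂ)⁻¹, (q : ℂ)] q k
                * qPochs [(q : ℂ) ^ (m₂ + k) * t * a * x₁, (q : ℂ) ^ (m₂ + k) * t * a * x₁⁻¹] q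
                    (m₁ - m₂ - k)
                * qPochs [(q : ℂ) ^ m₂ * a * x₂, (q : ℂ) ^ m₂ * a * x₂⁻¹] q k) ∧
        -- the symmetric double sum, over `j, k ≥ 0` with `j + k ≤ m₁ - m₂`
        (qPoch ((q : ℂ) ^ (2 * m₂) * t * a ^ 2) q (m₁ - m₂) ≠ 0 →
          P.value ![x₁, x₂] =
            bc2Prefactor q t a m₁ m₂ x₁ x₂
              * qPochs [(t : ℂ), (q : ℂ) ^ (2 * m₂) * t * a ^ 2] q (m₁ - m₂)
              * ∑ j ∈ Finset.range (m₁ - m₂ + 1), ∑ k ∈ Finset.range (m₁ - m₂ - j + 1),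
                  qPoch ((q : ℂ) ^ (-((m₁ - m₂ : ℕ) : ℤ))) q (j + k) * (q : ℂ) ^ (j + k)
                    / qPoch ((q : ℂ) ^ (2 * m₂) * t * a ^ 2) q (j + k)
                  * (qPochs [(q : ℂ) ^ m₂ * a * x₁, (q : ℂ) ^ m₂ * a * x₁⁻¹] q j
                    / qPochs [(q : ℂ) ^ (1 - ((m₁ - m₂ : ℕ) : ℤ)) * (t : ℂ)⁻¹, (q : ℂ)] q j)
                  * (qPochs [(q : ℂ) ^ m₂ * a * x₂, (q : ℂ) ^ m₂ * a * x₂⁻¹] q k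
                    / qPochs [(q : ℂ) ^ (1 - ((m₁ - m₂ : ℕ) : ℤ)) * (t : ℂ)⁻¹, (q : ℂ)] q k)) := by
  have hqc : (q : ℂ) ≠ 0 := by exact_mod_cast hq0.ne'
  have htc : (t : ℂ) ≠ 0 := by exact_mod_cast ht0.ne'
  have hq := qPoch_ofReal_ne_zero hq0 hq1 hq1 hq0
  have ht := qPoch_ofReal_ne_zero hq0 hq1 ht1 ht0
  refine ⟨⟨bcPoly q t a m₁ m₂, bcPoly_isBCInterpolation hq0 hq1 ht0 ht1 ha0 hm,
    fun P hP => hP.eq_bcPoly hq0 hq1 ht0 ht1 ha0 ha hm⟩, fun P hP x₁ x₂ hx₁ hx₂ => ?_⟩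
  have hval : P.value ![x₁, x₂] = bc2Prefactor q t a m₁ m₂ x₁ x₂
      * bcSum (q : ℂ) t (q ^ m₂ * a) (m₁ - m₂) (x₁ + x₁⁻¹) (x₂ + x₂⁻¹) := by
    rw [hP.eq_bcPoly hq0 hq1 ht0 ht1 ha0 ha hm, bcPoly_value _ _ _ _ _ _
      (fun i => by fin_cases i <;> assumption), bc2Prefactor_eq _ _ _ _ _ hx₁ hx₂]
    simp only [Matrix.cons_val_zero, Matrix.cons_val_one, mul_assoc]
  have hsingle : P.value ![x₁, x₂] = bc2Prefactor q t a m₁ m₂ x₁ x₂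
      * ∑ k ∈ range (m₁ - m₂ + 1),
        qPochs [(q : ℂ) ^ (-((m₁ - m₂ : ℕ) : ℤ)), (t : ℂ)] q k * (q : ℂ) ^ k
          / qPochs [(q : ℂ) ^ (1 - ((m₁ - m₂ : ℕ) : ℤ)) * (t : ℂ)⁻¹, (q : ℂ)] q k
        * qPochs [(q : ℂ) ^ (m₂ + k) * t * a * x₁, (q : ℂ) ^ (m₂ + k) * t * a * x₁⁻¹] q
            (m₁ - m₂ - k)
        * qPochs [(q : ℂ) ^ m₂ * a * x₂, (q : ℂ) ^ m₂ * a * x₂⁻¹] q k := by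
    rw [hval, bcSum]
    congr 1
    refine sum_congr rfl fun k hk => ?_
    rw [bcCoeff_eq hqc htc hq ht (Nat.lt_succ_iff.1 (mem_range.1 hk)), qPochSymm_complex _ _ hx₁,
      qPochSymm_complex _ _ hx₂, qPochs_pair, qPochs_pair, smul_eq_mul,
      show (q : ℂ) ^ (m₂ + k) * t * a = t * q ^ k * (q ^ m₂ * a) by ring]
    ring
  refine ⟨?_, fun hne => ?_, hsingle, fun hA => ?_⟩
  · rw [sub_eq_add_neg, zpow_add₀ hqc, zpow_one]
    field_simp
  · rw [hsingle, mul_assoc (bc2Prefactor _ _ _ _ _ _ _)]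
    congr 1
    rw [phi43, mul_sum]
    refine sum_congr rfl fun k hk => ?_
    have hk' : k ≤ m₁ - m₂ := Nat.lt_succ_iff.1 (mem_range.1 hk)
    -- The first `k` factors of the outer product cancel the lower parameters of the `k`-th term of
    -- the series; the remaining ones form the shifted product in (ii).
    have hsplit (z : ℂ) : qPoch ((q : ℂ) ^ m₂ * t * a * z) q (m₁ - m₂)
        = qPoch ((q : ℂ) ^ m₂ * t * a * z) q k
          * qPoch ((q : ℂ) ^ (m₂ + k) * t * a * z) q (m₁ - m₂ - k) := by
      rw [show (q : ℂ) ^ (m₂ + k) * t * a * z = (q : ℂ) ^ m₂ * t * a * z * q ^ k by ring,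
        ← qPoch_add, Nat.add_sub_cancel' hk']
    rw [qPochs_pair, hsplit x₁, hsplit x₁⁻¹] at hne
    have h1 := left_ne_zero_of_mul (left_ne_zero_of_mul hne)
    have h2 := left_ne_zero_of_mul (right_ne_zero_of_mul hne)
    simp only [qPochs, List.map_cons, List.map_nil, List.prod_cons, List.prod_nil, mul_one]
    rw [hsplit x₁, hsplit x₁⁻¹]
    clear hsplit hne
    generalize qPoch ((q : ℂ) ^ m₂ * t * a * x₁) q k = u at h1 ⊢
    generalize qPoch ((q : ℂ) ^ m₂ * t * a * x₁⁻¹) q k = v at h2 ⊢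
    field_simp
  · rw [hval, mul_assoc (bc2Prefactor _ _ _ _ _ _ _), bcSum_eq_symm hq]
    congr 1
    rw [mul_sum]
    refine sum_congr rfl fun j hj => ?_
    rw [mul_sum]
    refine sum_congr rfl fun k hk => ?_
    have hjk : j + k ≤ m₁ - m₂ := by
      have := mem_range.1 hj
      have := mem_range.1 hk
      omega
    rw [bcCoeffSymm_eq hqc htc hq ht hjk hA (b := q ^ m₂ * a) (by ring),
      qPochSymm_complex _ _ hx₁, qPochSymm_complex _ _ hx₂, qPochs_pair, qPochs_pair, smul_eq_mul]
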